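/- **Definitions.** Let $(\mathcal C,\otimes,\mathbb 1)$ and $(\mathcal C',\otimes',\mathbb 1')$ be monoidal categories; associators and unitors are suppressed in the formulas (as if the categories were strict) and are to be inserted where needed. An *extended Frobenius algebra* in $\mathcal C$ is a tuple $(A,m,u,\Delta,\varepsilon,\phi,\theta)$ where $(A,m,u)$ is an algebra and $(A,\Delta,\varepsilon)$ is a coalgebra in $\mathcal C$ with $(m\otimes \mathrm{id})(\mathrm{id}\otimes\Delta)=\Delta m=(\mathrm{id}\otimes m)(\Delta\otimes \mathrm{id})$, and $\phi:A\to A$, $\theta:\mathbb 1\to A$ are morphisms such that $\phi$ is a morphism of algebras and coalgebras, $\phi^2=\mathrm{id}_A$, $\phi\, m(\theta\otimes\mathrm{id})=m(\theta\otimes\mathrm{id})$ and $m(\phi\otimes\mathrm{id})\Delta u=m(\theta\otimes\theta)$. Morphisms in the category $\mathsf{ExtFrobAlg}(\mathcal C)$ are the morphisms $f:A\to B$ of algebras and coalgebras with $f\phi_A=\phi_Bf$ and $f\theta_A=\theta_B$. A *Frobenius monoidal functor* $F:\mathcal C\to\mathcal C'$ is a functor with a (lax) monoidal structure $F^{(2)}_{X,Y}:F(X)\otimes'F(Y)\to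 F(X\otimes Y)$, $F^{(0)}:\mathbb 1'\to F(\mathbb 1)$ and a comonoidal (oplax monoidal) structure $F_{(2)}^{X,Y}:F(X\otimes Y)\to F(X)\otimes'F(Y)$, $F_{(0)}:F(\mathbb 1)\to\mathbb 1'$ such that for all $X,Y,Z$ $$(F^{(2)}_{X,Y}\otimes'\mathrm{id}_{F(Z)})(\mathrm{id}_{F(X)}\otimes'F_{(2)}^{Y,Z})=F_{(2)}^{X\otimes Y,Z}F^{(2)}_{X,Y\otimes Z},\qquad (\mathrm{id}_{F(X)}\otimes'F^{(2)}_{Y,Z})(F_{(2)}^{X,Y}\otimes'\mathrm{id}_{F(Z)})=F_{(2)}^{X,Y\otimes Z}F^{(2)}_{X\otimes Y,Z}.$$ It is *separable* if $F^{(2)}_{X,Y}F_{(2)}^{X,Y}=\mathrm{id}_{F(X\otimes Y)}$ for all $X,Y$. A *Frobenius monoidal natural transformation* is a natural transformation between Frobenius monoidal functors that is both monoidal and comonoidal. An *extended Frobenius monoidal functor* is a Frobenius monoidal functor $F$ together with a Frobenius monoidal natural transformation $\widehat F:F\Rightarrow F$ and a morphism $\widecheck F:\mathbb 1'\to F(\mathbb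 1)$ such that, for all $X,Y\in\mathcal C$, - $F^{(2)}_{\mathbb 1,\mathbb 1}(\widehat F_{\mathbb 1}\otimes'\mathrm{id})F_{(2)}^{\mathbb 1,\mathbb 1}F^{(0)}=F^{(2)}_{\mathbb 1,\mathbb 1}(\widecheck F\otimes'\widecheck F)$; - $\widehat F_X\widehat F_X=\mathrm{id}_{F(X)}$; - $\widehat F_{\mathbb 1\otimes X}F^{(2)}_{\mathbb 1,X}(\widecheck F\otimes'\mathrm{id}_{F(X)})=F^{(2)}_{\mathbb 1,X}(\widecheck F\otimes'\mathrm{id}_{F(X)})$; - $F^{(2)}_{X,Y}(\widehat F_X\otimes'\mathrm{id}_{F(Y)})F_{(2)}^{X,Y}=F^{(2)}_{X\otimes Y,\mathbb 1}(\widehat F_{X\otimes Y}\otimes'\mathrm{id}_{F(\mathbb 1)})F_{(2)}^{X\otimes Y,\mathbb 1}$. **Theorem.** - (a) Every separable Frobenius monoidal functor $F$ is extended Frobenius monoidal with $\widehat F=\mathrm{id}_F$ and $\widecheck F=F^{(0)}$. - (b) Every extended Frobenius monoidal functor $F:\mathcal C\to\mathcal C'$ induces a functor $\mathsf{ExtFrobAlg}(\mathcal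 C)\to\mathsf{ExtFrobAlg}(\mathcal C')$ sending $f$ to $F(f)$ and $A$ to $F(A)$ with $m_{F(A)}=F(m_A)F^{(2)}_{A,A}$, $u_{F(A)}=F(u_A)F^{(0)}$, $\Delta_{F(A)}=F_{(2)}^{A,A}F(\Delta_A)$, $\varepsilon_{F(A)}=F_{(0)}F(\varepsilon_A)$, $\phi_{F(A)}=F(\phi_A)\widehat F_A$ and $\theta_{F(A)}=F(\theta_A)\widecheck F$. - (c) If $F:\mathcal C\to\mathcal C'$ and $G:\mathcal C'\to\mathcal C''$ are extended Frobenius monoidal functors, then $GF$, with the composite monoidal and comonoidal structures, is an extended Frobenius monoidal functor with $\widehat{GF}_X=G(\widehat F_X)\widehat G_{F(X)}$ and $\widecheck{GF}=G(\widecheck F)\widecheck G$. - (d) There is a (strict) 2-category whose 0-cells are the monoidal categories, whose 1-cells are the extended Frobenius monoidal functors, and whose 2-cells $F\Rightarrow G$ are the Frobenius monoidal natural transformations $\alpha$ that are compatible with the extended structures, i.e. $\alpha_X\widehat F_X=\widehat G_X\alpha_X$ for all $X$ and $\alpha_{\mathbb 1}\widecheck F=\widecheck G$. The identity 1-cell is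 the identity functor with identity structure maps, composition of 1-cells is as in (c), and identities and vertical and horizontal composition of 2-cells are the usual ones of natural transformations. -/

import Mathlib

open CategoryTheory MonoidalCategory

universe v₁ v₂ v₃ v u₁ u₂ u₃ u

namespace ExtFrob

section Functors

variable {C : Type u₁} [Category.{v₁} C] [MonoidalCategory C]
  {D : Type u₂} [Category.{v₂} D] [MonoidalCategory D]

open Functor.LaxMonoidal Functor.OplaxMonoidal

/-- A Frobenius monoidal functor: a functor with a monoidal structure `(μ, ε) = (F⁽²⁾, F⁽⁰⁾)`
and a comonoidal structure `(δ, η) = (F₍₂₎, F₍₀₎)` satisfying the two Frobenius conditions. -/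
structure IsFrobenius (F : C ⥤ D) [F.LaxMonoidal] [F.OplaxMonoidal] : Prop where
  left (X Y Z : C) :
    F.obj X ◁ δ F Y Z ≫ (α_ (F.obj X) (F.obj Y) (F.obj Z)).inv ≫ μ F X Y ▷ F.obj Z =
      μ F X (Y ⊗ Z) ≫ F.map (α_ X Y Z).inv ≫ δ F (X ⊗ Y) Z
  right (X Y Z : C) :
    δ F X Y ▷ F.obj Z ≫ (α_ (F.obj X) (F.obj Y) (F.obj Z)).hom ≫ F.obj X ◁ μ F Y Z =
      μ F (X ⊗ Y) Z ≫ F.map (α_ X Y Z).hom ≫ δ F X (Y ⊗ Z)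

/-- A separable Frobenius monoidal functor: `F⁽²⁾ ∘ F₍₂₎ = id`. -/
structure IsSeparableFrobenius (F : C ⥤ D) [F.LaxMonoidal] [F.OplaxMonoidal] : Prop where
  frobenius : IsFrobenius F
  separable (X Y : C) : δ F X Y ≫ μ F X Y = 𝟙 (F.obj (X ⊗ Y))

/-- A comonoidal natural transformation between comonoidal functors. -/
structure IsComonoidalTrans {F G : C ⥤ D} [F.OplaxMonoidal] [G.OplaxMonoidal]
    (τ : F ⟶ G) : Prop where
  counit : τ.app (𝟙_ C) ≫ η G = η F
  tensor (X Y : C) : δ F X Y ≫ (τ.app X ⊗ₘ τ.app Y) = τ.app (X ⊗ Y) ≫ δ G X Y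

/-- A Frobenius monoidal natural transformation: one that is monoidal and comonoidal. -/
structure IsFrobeniusTrans {F G : C ⥤ D} [F.LaxMonoidal] [F.OplaxMonoidal]
    [G.LaxMonoidal] [G.OplaxMonoidal] (τ : F ⟶ G) : Prop where
  monoidal : NatTrans.IsMonoidal τ
  comonoidal : IsComonoidalTrans τ

/-- `(F, hat, check)` is an extended Frobenius monoidal functor. The unitors are those that are
suppressed when the monoidal categories are taken to be strict. -/
structure IsExtended (F : C ⥤ D) [F.LaxMonoidal] [F.OplaxMonoidal]
    (hat : F ⟶ F) (check : 𝟙_ D ⟶ F.obj (𝟙_ C)) : Prop where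
  frobenius : IsFrobenius F
  hat_frobenius : IsFrobeniusTrans hat
  unit_comp :
    ε F ≫ F.map (ρ_ (𝟙_ C)).inv ≫ δ F (𝟙_ C) (𝟙_ C) ≫
        hat.app (𝟙_ C) ▷ F.obj (𝟙_ C) ≫ μ F (𝟙_ C) (𝟙_ C) =
      (ρ_ (𝟙_ D)).inv ≫ (check ⊗ₘ check) ≫ μ F (𝟙_ C) (𝟙_ C)
  hat_hat (X : C) : hat.app X ≫ hat.app X = 𝟙 (F.obj X)
  check_hat (X : C) :
    check ▷ F.obj X ≫ μ F (𝟙_ C) X ≫ hat.app (𝟙_ C ⊗ X) = check ▷ F.obj X ≫ μ F (𝟙_ C) X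
  hat_tensor (X Y : C) :
    δ F X Y ≫ hat.app X ▷ F.obj Y ≫ μ F X Y =
      F.map (ρ_ (X ⊗ Y)).inv ≫ δ F (X ⊗ Y) (𝟙_ C) ≫
        hat.app (X ⊗ Y) ▷ F.obj (𝟙_ C) ≫ μ F (X ⊗ Y) (𝟙_ C) ≫ F.map (ρ_ (X ⊗ Y)).hom

end Functors

section Algebras

variable {C : Type u₁} [Category.{v₁} C] [MonoidalCategory C]

open MonObj ComonObj

/-- `(A, m, u, Δ, ε, φ, θ)` is an extended Frobenius algebra in `C`, where `(m, u)` is the given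
algebra structure on `A` and `(Δ, ε)` is the given coalgebra structure. -/
structure IsExtFrobAlg (A : C) [MonObj A] [ComonObj A] (φ : A ⟶ A) (θ : 𝟙_ C ⟶ A) : Prop where
  frobenius_left :
    A ◁ comul (X := A) ≫ (α_ A A A).inv ≫ mul (X := A) ▷ A = mul (X := A) ≫ comul (X := A)
  frobenius_right :
    comul (X := A) ▷ A ≫ (α_ A A A).hom ≫ A ◁ mul (X := A) = mul (X := A) ≫ comul (X := A)
  phi_mon : IsMonHom φ
  phi_comon : IsComonHom φ
  phi_phi : φ ≫ φ = 𝟙 A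
  theta_phi : θ ▷ A ≫ mul (X := A) ≫ φ = θ ▷ A ≫ mul (X := A)
  theta_theta :
    one (X := A) ≫ comul (X := A) ≫ φ ▷ A ≫ mul (X := A) =
      (ρ_ (𝟙_ C)).inv ≫ (θ ⊗ₘ θ) ≫ mul (X := A)

variable (C) in
/-- The objects of the category of extended Frobenius algebras in `C`. -/
structure ExtFrobAlg where
  X : C
  [mon : MonObj X]
  [comon : ComonObj X]
  phi : X ⟶ X
  theta : 𝟙_ C ⟶ X
  isExtFrobAlg : IsExtFrobAlg X phi theta

attribute [instance] ExtFrobAlg.mon ExtFrobAlg.comon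

/-- A morphism of extended Frobenius algebras: a morphism of algebras and of coalgebras that is
compatible with `φ` and `θ`. -/
@[ext]
structure ExtFrobAlg.Hom (A B : ExtFrobAlg C) where
  hom : A.X ⟶ B.X
  isMonHom : IsMonHom hom
  isComonHom : IsComonHom hom
  phi_hom : A.phi ≫ hom = hom ≫ B.phi
  theta_hom : A.theta ≫ hom = B.theta

instance : Category (ExtFrobAlg C) where
  Hom A B := ExtFrobAlg.Hom A B
  id A := ⟨𝟙 A.X, inferInstance, inferInstance, by simp, by simp⟩
  comp {A B E} f g :=
    { hom := f.hom ≫ g.hom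
      isMonHom := by
        have := f.isMonHom
        have := g.isMonHom
        infer_instance
      isComonHom := by
        have := f.isComonHom
        have := g.isComonHom
        infer_instance
      phi_hom := by
        rw [← Category.assoc, f.phi_hom, Category.assoc, g.phi_hom, Category.assoc]
      theta_hom := by rw [← Category.assoc, f.theta_hom, g.theta_hom] }
  id_comp f := ExtFrobAlg.Hom.ext (Category.id_comp f.hom)
  comp_id f := ExtFrobAlg.Hom.ext (Category.comp_id f.hom)
  assoc f g h := ExtFrobAlg.Hom.ext (Category.assoc f.hom g.hom h.hom)

variable (C) in
/-- The forgetful functor from extended Frobenius algebras in `C` to `C`. -/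
def ExtFrobAlg.forget : ExtFrobAlg C ⥤ C where
  obj A := A.X
  map f := f.hom

end Algebras

section Cells

set_option linter.checkUnivs false in
/-- Bundled monoidal categories: the 0-cells. -/
structure MonoidalCat where
  carrier : Type u
  [cat : Category.{v} carrier]
  [monoidal : MonoidalCategory carrier]

attribute [instance] MonoidalCat.cat MonoidalCat.monoidal

/-- Bundled extended Frobenius monoidal functors: the 1-cells. -/
structure ExtFrobFunctor (C D : MonoidalCat.{v, u}) where
  functor : C.carrier ⥤ D.carrier
  [lax : functor.LaxMonoidal]
  [oplax : functor.OplaxMonoidal]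
  hat : functor ⟶ functor
  check : 𝟙_ D.carrier ⟶ functor.obj (𝟙_ C.carrier)
  isExtended : IsExtended functor hat check

attribute [instance] ExtFrobFunctor.lax ExtFrobFunctor.oplax

/-- Frobenius monoidal natural transformations compatible with the extended structures:
the 2-cells. -/
structure ExtFrobTrans {C D : MonoidalCat.{v, u}} (F G : ExtFrobFunctor C D) where
  trans : F.functor ⟶ G.functor
  isFrobeniusTrans : IsFrobeniusTrans trans
  hat_comp : F.hat ≫ trans = trans ≫ G.hat
  check_comp : F.check ≫ trans.app (𝟙_ C.carrier) = G.check

end Cells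

end ExtFrob

/-! An extended Frobenius algebra in `C` is the same data as an extended Frobenius monoidal functor
from the terminal monoidal category to `C`, so the object part of (b) and the composition law (c)
rest on the same calculations. Most axioms pass to composites by naturality: structure maps of the
outer functor are moved together, its axiom is applied, and the axiom of the inner functor is
applied under the outer functor. The unit axiom and the axiom comparing `hat` at `X` and at `X ⊗ Y`
need more, since the outer `δ ≫ hat ▷ _ ≫ μ` sits at a tensor product rather than at the unit. Write
`P_Z` for this composite at `(Z, 𝟙_ C)`, conjugated by right unitors; it is natural in `Z`. The last
extended axiom identifies the composite at `(X, Y)` with `P_{X ⊗ Y}`, so it slides along every map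
`Z ⟶ X ⊗ Y` (`IsExtended.map_comp_hat_tensor`), in particular back to the unit, where `unit_comp`
applies. For (d), composition of functors is strictly associative and unital by definition, so
equality of 1-cells reduces to comparing structure maps, and all coherence isomorphisms have
identity components. -/

namespace ExtFrob

/-! ### Identities and composites of Frobenius and extended structures -/

section Functors

variable {C : Type u₁} [Category.{v₁} C] [MonoidalCategory C]
  {D : Type u₂} [Category.{v₂} D] [MonoidalCategory D]
  {E : Type u₃} [Category.{v₃} E] [MonoidalCategory E]

open Functor.LaxMonoidal Functor.OplaxMonoidal

namespace IsComonoidalTrans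

lemma id (F : C ⥤ D) [F.OplaxMonoidal] : IsComonoidalTrans (𝟙 F) where
  counit := by simp
  tensor X Y := by simp

lemma comp {F G H : C ⥤ D} [F.OplaxMonoidal] [G.OplaxMonoidal] [H.OplaxMonoidal]
    {σ : F ⟶ G} {τ : G ⟶ H} (hσ : IsComonoidalTrans σ) (hτ : IsComonoidalTrans τ) :
    IsComonoidalTrans (σ ≫ τ) where
  counit := by rw [NatTrans.comp_app, Category.assoc, hτ.counit, hσ.counit]
  tensor X Y := by
    rw [NatTrans.comp_app, NatTrans.comp_app, NatTrans.comp_app,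
      ← tensorHom_comp_tensorHom, ← Category.assoc, hσ.tensor, Category.assoc, hτ.tensor,
      Category.assoc]

lemma hcomp {F F' : C ⥤ D} {G G' : D ⥤ E} [F.OplaxMonoidal] [F'.OplaxMonoidal]
    [G.OplaxMonoidal] [G'.OplaxMonoidal] {σ : F ⟶ F'} {τ : G ⟶ G'}
    (hσ : IsComonoidalTrans σ) (hτ : IsComonoidalTrans τ) :
    IsComonoidalTrans (NatTrans.hcomp σ τ) where
  counit := by
    simp only [comp_η, NatTrans.hcomp_app, Category.assoc]
    rw [← G'.map_comp_assoc, hσ.counit, ← NatTrans.naturality_assoc, hτ.counit]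
  tensor X Y := by
    simp only [comp_δ, NatTrans.hcomp_app, Category.assoc, ← tensorHom_comp_tensorHom]
    erw [reassoc_of% hτ.tensor (F.obj X) (F.obj Y)]
    rw [δ_natural, ← G'.map_comp_assoc, ← hσ.tensor, G'.map_comp, Category.assoc,
      NatTrans.naturality_assoc]

end IsComonoidalTrans

namespace IsFrobeniusTrans

lemma id (F : C ⥤ D) [F.LaxMonoidal] [F.OplaxMonoidal] : IsFrobeniusTrans (𝟙 F) where
  monoidal := inferInstance
  comonoidal := .id F

lemma comp {F G H : C ⥤ D} [F.LaxMonoidal] [F.OplaxMonoidal] [G.LaxMonoidal] [G.OplaxMonoidal]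
    [H.LaxMonoidal] [H.OplaxMonoidal]
    {σ : F ⟶ G} {τ : G ⟶ H} (hσ : IsFrobeniusTrans σ) (hτ : IsFrobeniusTrans τ) :
    IsFrobeniusTrans (σ ≫ τ) where
  monoidal := have := hσ.monoidal; have := hτ.monoidal; inferInstance
  comonoidal := hσ.comonoidal.comp hτ.comonoidal

lemma hcomp {F F' : C ⥤ D} {G G' : D ⥤ E} [F.LaxMonoidal] [F.OplaxMonoidal]
    [F'.LaxMonoidal] [F'.OplaxMonoidal] [G.LaxMonoidal] [G.OplaxMonoidal]
    [G'.LaxMonoidal] [G'.OplaxMonoidal] {σ : F ⟶ F'} {τ : G ⟶ G'}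
    (hσ : IsFrobeniusTrans σ) (hτ : IsFrobeniusTrans τ) :
    IsFrobeniusTrans (NatTrans.hcomp σ τ) where
  monoidal := have := hσ.monoidal; have := hτ.monoidal; inferInstance
  comonoidal := hσ.comonoidal.hcomp hτ.comonoidal

end IsFrobeniusTrans

namespace IsFrobenius

lemma id : IsFrobenius (𝟭 C) where
  left X Y Z := by simp
  right X Y Z := by simp

/-- The Frobenius relation of `G` at images of `F` moves `μ G` and `δ G` to the outside; naturality
then gathers all structure maps of `F` inside `G.map`, where the relation for `F` applies. -/
lemma comp {F : C ⥤ D} {G : D ⥤ E} [F.LaxMonoidal] [F.OplaxMonoidal]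
    [G.LaxMonoidal] [G.OplaxMonoidal] (hF : IsFrobenius F) (hG : IsFrobenius G) :
    IsFrobenius (F ⋙ G) where
  left X Y Z := by
    simp only [comp_δ, comp_μ, Functor.comp_obj, Functor.comp_map, comp_whiskerRight,
      MonoidalCategory.whiskerLeft_comp, Category.assoc]
    rw [reassoc_of% hG.left, μ_natural_right_assoc, δ_natural_left, ← G.map_comp_assoc,
      ← G.map_comp_assoc, ← G.map_comp_assoc, ← G.map_comp_assoc, Category.assoc, hF.left]
    simp only [Category.assoc]
  right X Y Z := by
    simp only [comp_δ, comp_μ, Functor.comp_obj, Functor.comp_map, comp_whiskerRight,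
      MonoidalCategory.whiskerLeft_comp, Category.assoc]
    rw [reassoc_of% hG.right, μ_natural_left_assoc, δ_natural_right, ← G.map_comp_assoc,
      ← G.map_comp_assoc, ← G.map_comp_assoc, ← G.map_comp_assoc, Category.assoc, hF.right]
    simp only [Category.assoc]

end IsFrobenius

namespace IsExtended

lemma id : IsExtended (𝟭 C) (𝟙 (𝟭 C)) (𝟙 (𝟙_ C)) where
  frobenius := .id
  hat_frobenius := .id _
  unit_comp := by simp
  hat_hat X := by simp
  check_hat X := by simp
  hat_tensor X Y := by simp

lemma of_separable {F : C ⥤ D} [F.LaxMonoidal] [F.OplaxMonoidal] (hF : IsSeparableFrobenius F) :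
    IsExtended F (𝟙 F) (ε F) where
  frobenius := hF.frobenius
  hat_frobenius := .id F
  unit_comp := by
    simp only [NatTrans.id_app, id_whiskerRight, Category.id_comp]
    -- The unit law reduces `(ε ⊗ₘ ε) ≫ μ` to `ε` up to left unitors, which agree with the right
    -- unitors at the unit object.
    rw [hF.separable, Category.comp_id, ε_tensorHom_comp_μ, leftUnitor_naturality_assoc,
      unitors_equal, Iso.inv_hom_id_assoc, unitors_inv_equal]
  hat_hat X := by simp
  check_hat X := by simp
  hat_tensor X Y := by
    simp only [NatTrans.id_app, id_whiskerRight, Category.id_comp]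
    rw [reassoc_of% hF.separable (X ⊗ Y) (𝟙_ C), hF.separable, ← F.map_comp, Iso.inv_hom_id,
      F.map_id]

variable {F : C ⥤ D} [F.LaxMonoidal] [F.OplaxMonoidal]
  {hatF : F ⟶ F} {checkF : 𝟙_ D ⟶ F.obj (𝟙_ C)}

/-- The endomorphism `δ ≫ hat ▷ _ ≫ μ` of `F.obj (X ⊗ Y)` depends only on the object `X ⊗ Y`, and
is natural in it. -/
lemma map_comp_hat_tensor (hF : IsExtended F hatF checkF) {X Y Z : C} (f : Z ⟶ X ⊗ Y) :
    F.map f ≫ δ F X Y ≫ hatF.app X ▷ F.obj Y ≫ μ F X Y =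
      F.map (ρ_ Z).inv ≫ δ F Z (𝟙_ C) ≫ hatF.app Z ▷ F.obj (𝟙_ C) ≫ μ F Z (𝟙_ C) ≫
        F.map (ρ_ Z).hom ≫ F.map f := by
  -- On the right-hand side, `F.map f` travels leftwards through `ρ`, `μ`, `hatF`, `δ` and `ρ⁻¹`.
  rw [hF.hat_tensor, ← F.map_comp (ρ_ Z).hom, ← rightUnitor_naturality, F.map_comp,
    ← μ_natural_left_assoc, ← comp_whiskerRight_assoc, ← hatF.naturality,
    comp_whiskerRight_assoc, δ_natural_left_assoc, ← F.map_comp_assoc, ← F.map_comp_assoc,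
    rightUnitor_inv_naturality]

lemma comp (hF : IsExtended F hatF checkF) {G : D ⥤ E} [G.LaxMonoidal] [G.OplaxMonoidal]
    {hatG : G ⟶ G} {checkG : 𝟙_ E ⟶ G.obj (𝟙_ D)} (hG : IsExtended G hatG checkG) :
    IsExtended (F ⋙ G) (NatTrans.hcomp hatF hatG) (checkG ≫ G.map checkF) where
  frobenius := hF.frobenius.comp hG.frobenius
  hat_frobenius := hF.hat_frobenius.hcomp hG.hat_frobenius
  unit_comp := by
    simp only [comp_δ, comp_μ, comp_ε, Functor.comp_obj, Functor.comp_map, NatTrans.hcomp_app,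
      comp_whiskerRight, Category.assoc, ← tensorHom_comp_tensorHom]
    rw [μ_natural_assoc, μ_natural_left_assoc]
    -- This slides the `hatG` composite back to `𝟙_ D`, next to `ε G`, where `unit_comp` for `G`
    -- applies.
    have key := hG.map_comp_hat_tensor (ε F ≫ F.map (ρ_ (𝟙_ C)).inv ≫ δ F _ _)
    simp only [Functor.map_comp, Category.assoc] at key
    rw [reassoc_of% key, reassoc_of% hG.unit_comp]
    have e := congrArg G.map hF.unit_comp
    simp only [Functor.map_comp] at e
    rw [e, Iso.map_hom_inv_id_assoc]
  hat_hat X := by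
    rw [NatTrans.hcomp_app]
    simp only [Category.assoc, Functor.comp_obj]
    rw [hatG.naturality_assoc, reassoc_of% hG.hat_hat, ← G.map_comp, hF.hat_hat, G.map_id]
  check_hat X := by
    simp only [comp_μ, Functor.comp_obj, NatTrans.hcomp_app,
      comp_whiskerRight, Category.assoc]
    -- Naturality brings `hatG` next to `μ G`, where `checkG` absorbs it; what remains is `G`
    -- applied to the axiom for `F`.
    rw [μ_natural_left_assoc, hatG.naturality_assoc, hatG.naturality_assoc,
      reassoc_of% hG.check_hat, ← G.map_comp, ← G.map_comp, hF.check_hat,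
      μ_natural_left_assoc, G.map_comp]
  hat_tensor X Y := by
    simp only [comp_δ, comp_μ, Functor.comp_obj, Functor.comp_map, NatTrans.hcomp_app,
      comp_whiskerRight, Category.assoc]
    rw [μ_natural_left_assoc, μ_natural_left_assoc]
    -- Both sides acquire the same `hatG` operator at `F.obj (X ⊗ Y)`, followed by `G` of the two
    -- sides of the axiom for `F`.
    have key := hG.map_comp_hat_tensor (δ F X Y)
    have key' := hG.map_comp_hat_tensor (F.map (ρ_ (X ⊗ Y)).inv ≫ δ F (X ⊗ Y) (𝟙_ C))
    have e := congrArg G.map (hF.hat_tensor X Y)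
    simp only [Functor.map_comp, Category.assoc] at key' e
    rw [reassoc_of% key, e, reassoc_of% key']

end IsExtended

end Functors

/-! ### The induced functor on extended Frobenius algebras -/

section InducedFunctor

variable {C : Type u₁} [Category.{v₁} C] [MonoidalCategory C]
  {D : Type u₂} [Category.{v₂} D] [MonoidalCategory D]
  {F : C ⥤ D} [F.LaxMonoidal] [F.OplaxMonoidal]

open Functor.LaxMonoidal Functor.OplaxMonoidal

attribute [local instance] Functor.monObjObj Functor.obj.instComonObj

lemma isComonHom_map (F : C ⥤ D) [F.OplaxMonoidal] {A B : C} [ComonObj A] [ComonObj B]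
    (f : A ⟶ B) [IsComonHom f] : IsComonHom (F.map f) where
  hom_counit := by
    change F.map f ≫ F.map ComonObj.counit ≫ η F = F.map ComonObj.counit ≫ η F
    rw [← F.map_comp_assoc, IsComonHom.hom_counit]
  hom_comul := by
    change F.map f ≫ F.map ComonObj.comul ≫ δ F B B =
      (F.map ComonObj.comul ≫ δ F A A) ≫ (F.map f ⊗ₘ F.map f)
    rw [Category.assoc, δ_natural, ← F.map_comp_assoc, ← F.map_comp_assoc, IsComonHom.hom_comul]

lemma IsComonoidalTrans.isComonHom_app {F G : C ⥤ D} [F.OplaxMonoidal] [G.OplaxMonoidal]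
    {τ : F ⟶ G} (hτ : IsComonoidalTrans τ) (A : C) [ComonObj A] : IsComonHom (τ.app A) where
  hom_counit := by
    change τ.app A ≫ G.map ComonObj.counit ≫ η G = F.map ComonObj.counit ≫ η F
    rw [← τ.naturality_assoc, hτ.counit]
  hom_comul := by
    change τ.app A ≫ G.map ComonObj.comul ≫ δ G A A =
      (F.map ComonObj.comul ≫ δ F A A) ≫ (τ.app A ⊗ₘ τ.app A)
    rw [Category.assoc, hτ.tensor, ← τ.naturality_assoc]

lemma isMonHom_app {F G : C ⥤ D} [F.LaxMonoidal] [G.LaxMonoidal]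
    (τ : F ⟶ G) [NatTrans.IsMonoidal τ] (A : C) [MonObj A] : IsMonHom (τ.app A) where
  one_hom := by
    change (ε F ≫ F.map MonObj.one) ≫ τ.app A = ε G ≫ G.map MonObj.one
    rw [Category.assoc, τ.naturality, NatTrans.IsMonoidal.unit_assoc]
  mul_hom := by
    change (μ F A A ≫ F.map MonObj.mul) ≫ τ.app A =
      (τ.app A ⊗ₘ τ.app A) ≫ μ G A A ≫ G.map MonObj.mul
    rw [Category.assoc, τ.naturality, NatTrans.IsMonoidal.tensor_assoc]

namespace IsExtended

variable {hat : F ⟶ F} {check : 𝟙_ D ⟶ F.obj (𝟙_ C)}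

lemma isExtFrobAlg_obj (hF : IsExtended F hat check) {A : C} [MonObj A] [ComonObj A]
    {φ : A ⟶ A} {θ : 𝟙_ C ⟶ A} (hA : IsExtFrobAlg A φ θ) :
    IsExtFrobAlg (F.obj A) (hat.app A ≫ F.map φ) (check ≫ F.map θ) where
  frobenius_left := by
    change F.obj A ◁ (F.map ComonObj.comul ≫ δ F A A) ≫ (α_ _ _ _).inv ≫
      (μ F A A ≫ F.map MonObj.mul) ▷ F.obj A =
      (μ F A A ≫ F.map MonObj.mul) ≫ F.map ComonObj.comul ≫ δ F A A
    simp only [MonoidalCategory.whiskerLeft_comp, comp_whiskerRight, Category.assoc]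
    rw [reassoc_of% hF.frobenius.left, δ_natural_left, μ_natural_right_assoc]
    simp only [← F.map_comp_assoc]
    rw [hA.frobenius_left]
  frobenius_right := by
    change (F.map ComonObj.comul ≫ δ F A A) ▷ F.obj A ≫ (α_ _ _ _).hom ≫
      F.obj A ◁ (μ F A A ≫ F.map MonObj.mul) =
      (μ F A A ≫ F.map MonObj.mul) ≫ F.map ComonObj.comul ≫ δ F A A
    simp only [MonoidalCategory.whiskerLeft_comp, comp_whiskerRight, Category.assoc]
    rw [reassoc_of% hF.frobenius.right, δ_natural_right, μ_natural_left_assoc]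
    simp only [← F.map_comp_assoc]
    rw [hA.frobenius_right]
  phi_mon := by
    have := hF.hat_frobenius.monoidal
    have := hA.phi_mon
    have := isMonHom_app hat A
    infer_instance
  phi_comon := by
    have := hF.hat_frobenius.comonoidal.isComonHom_app A
    have := hA.phi_comon
    have := isComonHom_map F φ
    infer_instance
  phi_phi := by
    rw [Category.assoc, hat.naturality_assoc, reassoc_of% hF.hat_hat, ← F.map_comp, hA.phi_phi,
      F.map_id]
  theta_phi := by
    change (check ≫ F.map θ) ▷ F.obj A ≫ (μ F A A ≫ F.map MonObj.mul) ≫ hat.app A ≫ F.map φ =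
      (check ≫ F.map θ) ▷ F.obj A ≫ μ F A A ≫ F.map MonObj.mul
    simp only [comp_whiskerRight, Category.assoc]
    rw [hat.naturality_assoc, μ_natural_left_assoc, hat.naturality_assoc,
      reassoc_of% hF.check_hat, ← F.map_comp, ← F.map_comp, hA.theta_phi, F.map_comp,
      μ_natural_left_assoc]
  theta_theta := by
    change (ε F ≫ F.map MonObj.one) ≫ (F.map ComonObj.comul ≫ δ F A A) ≫
      (hat.app A ≫ F.map φ) ▷ F.obj A ≫ μ F A A ≫ F.map MonObj.mul =
      (ρ_ (𝟙_ D)).inv ≫ ((check ≫ F.map θ) ⊗ₘ (check ≫ F.map θ)) ≫ μ F A A ≫ F.map MonObj.mul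
    simp only [comp_whiskerRight, Category.assoc, ← tensorHom_comp_tensorHom]
    -- As for composites: the `hat` operator slides from `A ⊗ A` back along `one ≫ comul` to the
    -- unit object.
    have key := hF.map_comp_hat_tensor (MonObj.one (X := A) ≫ ComonObj.comul)
    simp only [Functor.map_comp, Category.assoc] at key
    have e := congrArg F.map hA.theta_theta
    simp only [Functor.map_comp] at e
    rw [μ_natural_left_assoc, reassoc_of% key, reassoc_of% hF.unit_comp, e,
      Iso.map_hom_inv_id_assoc, μ_natural_assoc]

/-- The functor on extended Frobenius algebras induced by an extended Frobenius monoidal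
functor. -/
def mapExtFrobAlg (hF : IsExtended F hat check) : ExtFrobAlg C ⥤ ExtFrobAlg D where
  obj A :=
    { X := F.obj A.X
      phi := hat.app A.X ≫ F.map A.phi
      theta := check ≫ F.map A.theta
      isExtFrobAlg := hF.isExtFrobAlg_obj A.isExtFrobAlg }
  map {A B} f :=
    { hom := F.map f.hom
      isMonHom := have := f.isMonHom; inferInstance
      isComonHom := have := f.isComonHom; isComonHom_map F f.hom
      phi_hom := by
        rw [Category.assoc, ← F.map_comp, f.phi_hom, F.map_comp, hat.naturality_assoc]
      theta_hom := by rw [Category.assoc, ← F.map_comp, f.theta_hom] }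
  map_id A := ExtFrobAlg.Hom.ext (F.map_id A.X)
  map_comp f g := ExtFrobAlg.Hom.ext (F.map_comp f.hom g.hom)

end IsExtended

end InducedFunctor

/-! ### The strict 2-category -/

section Bicategory

open Functor.LaxMonoidal Functor.OplaxMonoidal

namespace ExtFrobTrans

variable {C D E : MonoidalCat.{v, u}}

lemma ext' {F G : ExtFrobFunctor C D} {σ τ : ExtFrobTrans F G} (h : σ.trans = τ.trans) :
    σ = τ := by
  cases σ; cases τ; congr

/-- The identity 2-cell. -/
def id (F : ExtFrobFunctor C D) : ExtFrobTrans F F where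
  trans := 𝟙 F.functor
  isFrobeniusTrans := .id _
  hat_comp := by simp
  check_comp := by simp

/-- The vertical composition of 2-cells. -/
def comp {F G H : ExtFrobFunctor C D} (σ : ExtFrobTrans F G) (τ : ExtFrobTrans G H) :
    ExtFrobTrans F H where
  trans := σ.trans ≫ τ.trans
  isFrobeniusTrans := σ.isFrobeniusTrans.comp τ.isFrobeniusTrans
  hat_comp := by
    rw [← Category.assoc, σ.hat_comp, Category.assoc, τ.hat_comp, Category.assoc]
  check_comp := by
    rw [NatTrans.comp_app, ← Category.assoc, σ.check_comp, τ.check_comp]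

end ExtFrobTrans

instance (C D : MonoidalCat.{v, u}) : Category (ExtFrobFunctor C D) where
  Hom F G := ExtFrobTrans F G
  id F := ExtFrobTrans.id F
  comp σ τ := ExtFrobTrans.comp σ τ
  id_comp σ := ExtFrobTrans.ext' (Category.id_comp σ.trans)
  comp_id σ := ExtFrobTrans.ext' (Category.comp_id σ.trans)
  assoc σ τ υ := ExtFrobTrans.ext' (Category.assoc σ.trans τ.trans υ.trans)

namespace ExtFrobFunctor

variable {C D E : MonoidalCat.{v, u}}

@[ext]
lemma hom_ext {F G : ExtFrobFunctor C D} {σ τ : F ⟶ G}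
    (h : ∀ X, σ.trans.app X = τ.trans.app X) : σ = τ :=
  ExtFrobTrans.ext' (NatTrans.ext (funext h))

@[simp]
lemma comp_trans_app {F G H : ExtFrobFunctor C D} (σ : F ⟶ G) (τ : G ⟶ H) (X : C.carrier) :
    (σ ≫ τ).trans.app X = σ.trans.app X ≫ τ.trans.app X := rfl

variable (C) in
/-- The identity 1-cell. -/
def id : ExtFrobFunctor C C where
  functor := 𝟭 C.carrier
  hat := 𝟙 (𝟭 C.carrier)
  check := 𝟙 (𝟙_ C.carrier)
  isExtended := .id

/-- The composition of 1-cells. -/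
def comp (F : ExtFrobFunctor C D) (G : ExtFrobFunctor D E) : ExtFrobFunctor C E where
  functor := F.functor ⋙ G.functor
  hat := NatTrans.hcomp F.hat G.hat
  check := G.check ≫ G.functor.map F.check
  isExtended := F.isExtended.comp G.isExtended

/-- Left whiskering of 2-cells. -/
@[simps trans]
def whiskerLeft (F : ExtFrobFunctor C D) {G H : ExtFrobFunctor D E} (τ : G ⟶ H) :
    F.comp G ⟶ F.comp H where
  trans := Functor.whiskerLeft F.functor τ.trans
  isFrobeniusTrans := by
    rw [← Functor.id_hcomp]
    -- Whiskering is horizontal composition with an identity transformation.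
    exact (IsFrobeniusTrans.id F.functor).hcomp τ.isFrobeniusTrans
  hat_comp := by
    ext X
    change (G.hat.app _ ≫ G.functor.map (F.hat.app X)) ≫ τ.trans.app _ =
      τ.trans.app _ ≫ H.hat.app _ ≫ H.functor.map (F.hat.app X)
    have h : G.hat.app _ ≫ τ.trans.app _ = τ.trans.app _ ≫ H.hat.app _ :=
      congr_app τ.hat_comp (F.functor.obj X)
    rw [Category.assoc, τ.trans.naturality, reassoc_of% h]
  check_comp := by
    change (G.check ≫ G.functor.map F.check) ≫ τ.trans.app _ = H.check ≫ H.functor.map F.check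
    rw [Category.assoc, τ.trans.naturality, ← τ.check_comp, Category.assoc]

/-- Right whiskering of 2-cells. -/
@[simps trans]
def whiskerRight {F G : ExtFrobFunctor C D} (σ : F ⟶ G) (H : ExtFrobFunctor D E) :
    F.comp H ⟶ G.comp H where
  trans := Functor.whiskerRight σ.trans H.functor
  isFrobeniusTrans := by
    rw [← Functor.hcomp_id]
    exact σ.isFrobeniusTrans.hcomp (IsFrobeniusTrans.id H.functor)
  hat_comp := by
    ext X
    change (H.hat.app _ ≫ H.functor.map (F.hat.app X)) ≫ H.functor.map (σ.trans.app X) =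
      H.functor.map (σ.trans.app X) ≫ H.hat.app _ ≫ H.functor.map (G.hat.app X)
    have h : F.hat.app X ≫ σ.trans.app X = σ.trans.app X ≫ G.hat.app X :=
      congr_app σ.hat_comp X
    rw [Category.assoc, ← H.functor.map_comp, h, H.functor.map_comp, H.hat.naturality_assoc]
  check_comp := by
    change (H.check ≫ H.functor.map F.check) ≫ H.functor.map (σ.trans.app _) =
      H.check ≫ H.functor.map G.check
    rw [Category.assoc, ← H.functor.map_comp, σ.check_comp]

/-- Two extended Frobenius monoidal functors with the same underlying functor and the same
structure maps are equal. -/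
lemma ext_of_functor_eq {T : C.carrier ⥤ D.carrier} {l l' : T.LaxMonoidal}
    {o o' : T.OplaxMonoidal} {a a' : T ⟶ T} {c c' : 𝟙_ D.carrier ⟶ T.obj (𝟙_ C.carrier)}
    (h : @IsExtended _ _ _ _ _ _ T l o a c) (h' : @IsExtended _ _ _ _ _ _ T l' o' a' c')
    (hε : l.ε = l'.ε) (hμ : l.μ = l'.μ) (hη : o.η = o'.η) (hδ : o.δ = o'.δ)
    (ha : a = a') (hc : c = c') :
    (@ExtFrobFunctor.mk C D T l o a c h) = @ExtFrobFunctor.mk C D T l' o' a' c' h' := by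
  obtain rfl : l = l' := Functor.LaxMonoidal.ext hε hμ
  obtain rfl : o = o' := Functor.OplaxMonoidal.ext hη hδ
  subst ha hc
  rfl

/-- The underlying functors agree definitionally, so no transport is needed; each structure map
differs only by a factor `F.functor.map (𝟙 _)`. -/
lemma id_comp (F : ExtFrobFunctor C D) : (id C).comp F = F := by
  refine ext_of_functor_eq (T := F.functor) _ F.isExtended ?_ ?_ ?_ ?_ ?_ ?_
  · exact (congrArg _ (F.functor.map_id _)).trans (Category.comp_id _)
  · funext X Y; exact (congrArg _ (F.functor.map_id _)).trans (Category.comp_id _)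
  · exact (congrArg (· ≫ _) (F.functor.map_id _)).trans (Category.id_comp _)
  · funext X Y; exact (congrArg (· ≫ _) (F.functor.map_id _)).trans (Category.id_comp _)
  · ext X; exact (congrArg _ (F.functor.map_id _)).trans (Category.comp_id _)
  · exact (congrArg _ (F.functor.map_id _)).trans (Category.comp_id _)

lemma comp_id (F : ExtFrobFunctor C D) : F.comp (id D) = F := by
  refine ext_of_functor_eq (T := F.functor) _ F.isExtended ?_ ?_ ?_ ?_ ?_ ?_
  · exact Category.id_comp _
  · funext X Y; exact Category.id_comp _
  · exact Category.comp_id _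
  · funext X Y; exact Category.comp_id _
  · ext X; exact Category.id_comp _
  · exact Category.id_comp _

lemma assoc {C' : MonoidalCat.{v, u}} (F : ExtFrobFunctor C D) (G : ExtFrobFunctor D E)
    (H : ExtFrobFunctor E C') : (F.comp G).comp H = F.comp (G.comp H) := by
  refine ext_of_functor_eq (T := F.functor ⋙ G.functor ⋙ H.functor) _ _ ?_ ?_ ?_ ?_ ?_ ?_
  · exact (congrArg (ε H.functor ≫ ·) (H.functor.map_comp _ _)).trans (Category.assoc _ _ _).symm
  · funext X Y
    exact (congrArg (μ H.functor _ _ ≫ ·) (H.functor.map_comp _ _)).trans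
      (Category.assoc _ _ _).symm
  · exact (congrArg (· ≫ η H.functor) (H.functor.map_comp _ _)).trans (Category.assoc _ _ _)
  · funext X Y
    exact (congrArg (· ≫ δ H.functor _ _) (H.functor.map_comp _ _)).trans (Category.assoc _ _ _)
  · ext X
    exact (congrArg _ (H.functor.map_comp _ _)).trans (Category.assoc _ _ _).symm
  · exact (congrArg _ (H.functor.map_comp _ _)).trans (Category.assoc _ _ _).symm

/-- Reduces the bicategory coherence laws to statements about `eqToHom` between objects of the
target category. -/
lemma eqToHom_trans_app {F G : ExtFrobFunctor C D} (h : F = G) (X : C.carrier) :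
    (eqToHom h).trans.app X = eqToHom (congrArg (fun F ↦ F.functor.obj X) h) := by
  subst h; rfl

end ExtFrobFunctor

open ExtFrobFunctor

/-- The strict 2-category of monoidal categories, extended Frobenius monoidal functors, and
compatible Frobenius monoidal natural transformations. -/
@[reducible]
def MonoidalCat.bicategory : Bicategory.{max u v, max u v} MonoidalCat.{v, u} where
  Hom C D := ExtFrobFunctor C D
  id C := ExtFrobFunctor.id C
  comp F G := F.comp G
  homCategory C D := inferInstance
  whiskerLeft F _ _ τ := ExtFrobFunctor.whiskerLeft F τ
  whiskerRight σ H := ExtFrobFunctor.whiskerRight σ H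
  associator F G H := eqToIso (ExtFrobFunctor.assoc F G H)
  leftUnitor F := eqToIso (ExtFrobFunctor.id_comp F)
  rightUnitor F := eqToIso (ExtFrobFunctor.comp_id F)
  whiskerLeft_id _ _ := rfl
  whiskerLeft_comp _ _ _ _ _ _ := rfl
  id_whiskerLeft _ := by
    ext X
    simp only [comp_trans_app, eqToIso.hom, eqToIso.inv, eqToHom_trans_app]
    -- Each `eqToHom` here joins definitionally equal objects, so it unfolds to an identity.
    exact (Category.id_comp _ |>.trans (Category.comp_id _)).symm
  comp_whiskerLeft _ _ _ _ _ := by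
    ext X
    simp only [comp_trans_app, eqToIso.hom, eqToIso.inv, eqToHom_trans_app]
    exact (Category.id_comp _ |>.trans (Category.comp_id _)).symm
  id_whiskerRight _ G := by
    ext X
    exact G.functor.map_id _
  comp_whiskerRight _ _ H := by
    ext X
    exact H.functor.map_comp _ _
  whiskerRight_id _ := by
    ext X
    simp only [comp_trans_app, eqToIso.hom, eqToIso.inv, eqToHom_trans_app]
    exact (Category.id_comp _ |>.trans (Category.comp_id _)).symm
  whiskerRight_comp _ _ _ := by
    ext X
    simp only [comp_trans_app, eqToIso.hom, eqToIso.inv, eqToHom_trans_app]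
    exact (Category.id_comp _ |>.trans (Category.comp_id _)).symm
  whisker_assoc _ _ _ _ _ := by
    ext X
    simp only [comp_trans_app, eqToIso.hom, eqToIso.inv, eqToHom_trans_app]
    exact (Category.id_comp _ |>.trans (Category.comp_id _)).symm
  whisker_exchange σ τ := by
    ext X
    exact (τ.trans.naturality (σ.trans.app X)).symm
  pentagon F G H I := by
    ext X
    simp only [comp_trans_app, eqToIso.hom, whiskerLeft_trans, whiskerRight_trans,
      Functor.whiskerLeft_app, Functor.whiskerRight_app, eqToHom_trans_app]
    simp only [eqToHom_map]
    exact ((eqToHom_trans_assoc _ _ _).trans (eqToHom_trans _ _)).trans (eqToHom_trans _ _).symm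
  triangle F G := by
    ext X
    simp only [comp_trans_app, eqToIso.hom, whiskerLeft_trans, whiskerRight_trans,
      Functor.whiskerLeft_app, Functor.whiskerRight_app, eqToHom_trans_app]
    simp only [eqToHom_map]
    exact eqToHom_trans _ _

lemma MonoidalCat.bicategory_strict :
    @Bicategory.Strict MonoidalCat.{v, u} MonoidalCat.bicategory :=
  letI := MonoidalCat.bicategory.{v, u}
  { id_comp := ExtFrobFunctor.id_comp
    comp_id := ExtFrobFunctor.comp_id
    assoc := ExtFrobFunctor.assoc
    leftUnitor_eqToIso _ := rfl
    rightUnitor_eqToIso _ := rfl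
    associator_eqToIso _ _ _ := rfl }

end Bicategory

end ExtFrob

theorem theorem1p5 :
    -- (a) separable Frobenius monoidal functors are extended, via the identity and the unit map
    (∀ {C : Type u₁} [Category.{v₁} C] [MonoidalCategory C]
        {D : Type u₂} [Category.{v₂} D] [MonoidalCategory D]
        (F : C ⥤ D) [F.LaxMonoidal] [F.OplaxMonoidal],
      ExtFrob.IsSeparableFrobenius F →
        ExtFrob.IsExtended F (𝟙 F) (Functor.LaxMonoidal.ε F)) ∧
    -- (b) an extended Frobenius monoidal functor induces a functor on extended Frobenius algebras,
    -- where `F.obj A` carries the algebra and coalgebra structures induced by those of `F`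
    (∀ {C : Type u₁} [Category.{v₁} C] [MonoidalCategory C]
        {D : Type u₂} [Category.{v₂} D] [MonoidalCategory D]
        (F : C ⥤ D) [F.LaxMonoidal] [F.OplaxMonoidal]
        (hat : F ⟶ F) (check : 𝟙_ D ⟶ F.obj (𝟙_ C)),
      ExtFrob.IsExtended F hat check →
        ∃ Φ : ExtFrob.ExtFrobAlg C ⥤ ExtFrob.ExtFrobAlg D,
          (∀ A : ExtFrob.ExtFrobAlg C, ∃ h, Φ.obj A =
            { X := F.obj A.X
              mon := Functor.monObjObj (F := F) (X := A.X)
              comon := Functor.obj.instComonObj A.X F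
              phi := hat.app A.X ≫ F.map A.phi
              theta := check ≫ F.map A.theta
              isExtFrobAlg := h }) ∧
          Φ ⋙ ExtFrob.ExtFrobAlg.forget D = ExtFrob.ExtFrobAlg.forget C ⋙ F) ∧
    -- (c) extended Frobenius monoidal functors are closed under composition; the composite has
    -- components `G(F̂_X) ∘ Ĝ_{F(X)}` and `G(F̌) ∘ Ǧ`
    (∀ {C : Type u₁} [Category.{v₁} C] [MonoidalCategory C]
        {D : Type u₂} [Category.{v₂} D] [MonoidalCategory D]
        {E : Type u₃} [Category.{v₃} E] [MonoidalCategory E]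
        (F : C ⥤ D) [F.LaxMonoidal] [F.OplaxMonoidal]
        (hatF : F ⟶ F) (checkF : 𝟙_ D ⟶ F.obj (𝟙_ C))
        (G : D ⥤ E) [G.LaxMonoidal] [G.OplaxMonoidal]
        (hatG : G ⟶ G) (checkG : 𝟙_ E ⟶ G.obj (𝟙_ D)),
      ExtFrob.IsExtended F hatF checkF → ExtFrob.IsExtended G hatG checkG →
        ExtFrob.IsExtended (F ⋙ G) (NatTrans.hcomp hatF hatG) (checkG ≫ G.map checkF)) ∧
    -- (d) there is a (strict) 2-category whose 0-cells are the monoidal categories, whose 1-cells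
    -- are (via `e₁`) the extended Frobenius monoidal functors, and whose 2-cells are (via `e₂`) the
    -- compatible Frobenius monoidal natural transformations, with the usual identities and
    -- compositions
    (∃ (B : Bicategory.{max u v, max u v} ExtFrob.MonoidalCat.{v, u})
        (e₁ : ∀ C D : ExtFrob.MonoidalCat.{v, u}, (C ⟶ D) ≃ ExtFrob.ExtFrobFunctor C D)
        (e₂ : ∀ {C D : ExtFrob.MonoidalCat.{v, u}} (f g : C ⟶ D),
          (f ⟶ g) ≃ ExtFrob.ExtFrobTrans (e₁ C D f) (e₁ C D g)),
      Bicategory.Strict ExtFrob.MonoidalCat.{v, u} ∧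
      (∀ C : ExtFrob.MonoidalCat.{v, u}, ∃ h, e₁ C C (𝟙 C) =
        { functor := 𝟭 C.carrier
          hat := 𝟙 (𝟭 C.carrier)
          check := 𝟙 (𝟙_ C.carrier)
          isExtended := h }) ∧
      (∀ {C D E : ExtFrob.MonoidalCat.{v, u}} (f : C ⟶ D) (g : D ⟶ E), ∃ h, e₁ C E (f ≫ g) =
        { functor := (e₁ C D f).functor ⋙ (e₁ D E g).functor
          hat := NatTrans.hcomp (e₁ C D f).hat (e₁ D E g).hat
          check := (e₁ D E g).check ≫ (e₁ D E g).functor.map (e₁ C D f).check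
          isExtended := h }) ∧
      (∀ {C D : ExtFrob.MonoidalCat.{v, u}} (f : C ⟶ D),
        (e₂ f f (𝟙 f)).trans = 𝟙 (e₁ C D f).functor) ∧
      (∀ {C D : ExtFrob.MonoidalCat.{v, u}} {f g h : C ⟶ D} (σ : f ⟶ g) (τ : g ⟶ h),
        (e₂ f h (σ ≫ τ)).trans = (e₂ f g σ).trans ≫ (e₂ g h τ).trans) ∧
      (∀ {C D E : ExtFrob.MonoidalCat.{v, u}} (f : C ⟶ D) {g h : D ⟶ E} (τ : g ⟶ h),
        HEq (e₂ (f ≫ g) (f ≫ h) (Bicategory.whiskerLeft f τ)).trans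
          (Functor.whiskerLeft (e₁ C D f).functor (e₂ g h τ).trans)) ∧
      (∀ {C D E : ExtFrob.MonoidalCat.{v, u}} {f g : C ⟶ D} (σ : f ⟶ g) (h : D ⟶ E),
        HEq (e₂ (f ≫ h) (g ≫ h) (Bicategory.whiskerRight σ h)).trans
          (Functor.whiskerRight (e₂ f g σ).trans (e₁ D E h).functor))) := by
  refine ⟨fun F _ _ hF ↦ .of_separable hF,
    fun F _ _ hat check hF ↦ ⟨hF.mapExtFrobAlg, fun A ↦ ⟨_, rfl⟩, rfl⟩,
    fun F _ _ hatF checkF G _ _ hatG checkG hF hG ↦ hF.comp hG, ?_⟩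
  -- The cells are the bundled structures themselves, so `e₁` and `e₂` are identities and every
  -- compatibility, heterogeneous ones included, holds by reflexivity.
  exact ⟨ExtFrob.MonoidalCat.bicategory, fun C D ↦ Equiv.refl _, fun f g ↦ Equiv.refl _,
    ExtFrob.MonoidalCat.bicategory_strict, fun C ↦ ⟨_, rfl⟩, fun f g ↦ ⟨_, rfl⟩, fun f ↦ rfl,
    fun σ τ ↦ rfl, fun f _ _ τ ↦ HEq.rfl, fun σ h ↦ HEq.rfl⟩
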